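/- All graphs are finite and simple; the null graph $K_0$ (no vertices) is allowed. Let $G$ be a graph. A vertex of $G$ is active if it is one of the four entries of a 2-switch acting on $G$, that is, if it lies in $\{a,b,c,d\}$ for some four distinct vertices with $ab,cd\in E(G)$ and $ac,bd\notin E(G)$. The graph $G$ is active if all its vertices are active. It is twin-free if $N_G(u)\setminus\{v\}\neq N_G(v)\setminus\{u\}$ for all distinct vertices $u,v$. A split graph $(S,K,I)$ is a non-null graph $S$ whose vertex set is the disjoint union of a clique $K$ and an independent set $I$ (one of them may be empty). If $H$ is a graph disjoint from $S$, the Tyshkevich composition $S\circ H$ is the graph with vertex set $V(S)\cup V(H)$ and edge set $E(S)\cup E(H)\cup\{xy : x\in K,\ y\in V(H)\}$. A graph is reducible if it equals $S\circ H$ for some split graph $(S,K,I)$ and some non-null graph $H$, and irreducible otherwise. A graph is prime if it is active and irreducible, and elemental if it is prime and twin-free. **Theorem.** Every active, twin-free graph $G$ can be written uniquely as a composition $$G = G_n\circ\cdots\circ G_2\circ G_1,\qquad n\ge 1,$$ of elemental graphs, where each $G_r$ with $r\ge 2$ is a split graph with a fixed bipartition $(K_r,I_r)$, and all factors are non-null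 if $n\geq 2$. Uniqueness means: if $G = G_n\circ\cdots\circ G_1$ and $G = G'_m\circ\cdots\circ G'_1$ are two such expressions (with equality replaced by isomorphism if the factors are given only up to isomorphism), then $n=m$, and the identification of the two products with $G$ restricts, for every $r$, to an isomorphism $G_r\to G'_r$ which, for $r\ge 2$, carries $K_r$ to $K'_r$ and $I_r$ to $I'_r$. In particular, corresponding factors are isomorphic, their order is determined, and as subgraphs of $G$ the factors and their bipartitions are uniquely determined. -/

import Mathlib

universe u

/-- The vertex `v` is active in `G`: it is one of the four vertices of a 2-switch acting on `G`,
which replaces two disjoint edges `ab`, `cd` of `G` by two non-edges `ac`, `bd`. -/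
def IsActiveVertex {V : Type u} (G : SimpleGraph V) (v : V) : Prop :=
  ∃ a b c d : V, G.Adj a b ∧ G.Adj c d ∧ Disjoint ({a, b} : Set V) {c, d} ∧
    ¬ G.Adj a c ∧ ¬ G.Adj b d ∧ v ∈ ({a, b, c, d} : Set V)

/-- A graph is active if all of its vertices are active (so the null graph is active). -/
def IsActive {V : Type u} (G : SimpleGraph V) : Prop :=
  ∀ v : V, IsActiveVertex G v

/-- Two vertices are twins if their neighbourhoods agree, apart from the two vertices themselves. -/
def AreTwins {V : Type u} (G : SimpleGraph V) (x y : V) : Prop :=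
  G.neighborSet x \ {y} = G.neighborSet y \ {x}

/-- A graph is twin-free if no two distinct vertices are twins. -/
def IsTwinFree {V : Type u} (G : SimpleGraph V) : Prop :=
  ∀ x y : V, x ≠ y → ¬ AreTwins G x y

/-- A (bipartitioned) split graph `(S, K, I)`: a non-null graph `S` whose vertex set is the
disjoint union of a clique `K` and an independent set `I`, either of which may be empty. -/
structure SplitGraph : Type (u + 1) where
  Vertex : Type u
  graph : SimpleGraph Vertex
  K : Set Vertex
  I : Set Vertex
  nonempty : Nonempty Vertex
  isClique : graph.IsClique K
  isIndepSet : graph.IsIndepSet I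
  disjoint : Disjoint K I
  union_eq : K ∪ I = Set.univ

/-- The Tyshkevich composition `S ∘ H`: the disjoint union of `S` and `H`, together with all
edges between the clique `K` of `S` and the vertices of `H`. -/
def SplitGraph.comp (S : SplitGraph.{u}) {V : Type u} (H : SimpleGraph V) :
    SimpleGraph (S.Vertex ⊕ V) where
  Adj
    | Sum.inl x, Sum.inl y => S.graph.Adj x y
    | Sum.inr x, Sum.inr y => H.Adj x y
    | Sum.inl x, Sum.inr _ => x ∈ S.K
    | Sum.inr _, Sum.inl y => y ∈ S.K
  symm := ⟨by
    rintro (x | x) (y | y) h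
    · exact S.graph.adj_symm h
    · exact h
    · exact h
    · exact H.adj_symm h⟩
  loopless := ⟨by
    rintro (x | x) h
    · exact S.graph.loopless.irrefl x h
    · exact H.loopless.irrefl x h⟩

/-- A graph is reducible if it is the composition of a (non-null, by definition) split graph and
a non-null graph; otherwise it is irreducible. -/
def IsReducible {V : Type u} (G : SimpleGraph V) : Prop :=
  ∃ (S : SplitGraph.{u}) (W : Type u) (H : SimpleGraph W),
    Nonempty W ∧ Nonempty (G ≃g S.comp H)

/-- A graph is prime if it is active and irreducible. -/
def IsPrimeGraph {V : Type u} (G : SimpleGraph V) : Prop :=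
  IsActive G ∧ ¬ IsReducible G

/-- A graph is elemental if it is prime and twin-free. -/
def IsElemental {V : Type u} (G : SimpleGraph V) : Prop :=
  IsPrimeGraph G ∧ IsTwinFree G

/-- A sequence of factors `Gₙ, …, G₂, G₁`, `n ≥ 1`, to be composed: every factor except the last
one, `G₁`, is a split graph with a fixed bipartition. -/
inductive FactorSeq : Type (u + 1)
  | last {V : Type u} (G : SimpleGraph V) : FactorSeq
  | cons (S : SplitGraph.{u}) (F : FactorSeq) : FactorSeq

namespace FactorSeq

/-- The vertex set of `Gₙ ∘ ⋯ ∘ G₁`: the disjoint union of those of the factors. -/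
def Vertex : FactorSeq.{u} → Type u
  | @last V _ => V
  | cons S F => S.Vertex ⊕ F.Vertex

/-- The composition `Gₙ ∘ ⋯ ∘ G₁`. -/
def product : (F : FactorSeq.{u}) → SimpleGraph F.Vertex
  | last G => G
  | cons S F => S.comp F.product

/-- Every factor is elemental. -/
def AllElemental : FactorSeq.{u} → Prop
  | last G => IsElemental G
  | cons S F => IsElemental S.graph ∧ F.AllElemental

/-- Every factor is non-null. -/
def AllNonnull : FactorSeq.{u} → Prop
  | @last V _ => Nonempty V
  | cons S F => Nonempty S.Vertex ∧ F.AllNonnull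

/-- There is no superfluous null factor: all factors are non-null, except that a sequence may
consist of the null graph alone. -/
def NoSuperfluousNull : FactorSeq.{u} → Prop
  | last _ => True
  | cons S F => (cons S F).AllNonnull

/-- The sequence `F` is a decomposition into elemental graphs (of its product). -/
def IsElementalDecomposition (F : FactorSeq.{u}) : Prop :=
  F.AllElemental ∧ F.NoSuperfluousNull

/-- The map `f` between the vertex sets of two products is assembled from isomorphisms between
corresponding factors: the sequences have the same number of factors, and `f` restricts, for each
position, to an isomorphism between the factors at that position, which carries the bipartition
to the bipartition unless the position is the last one. -/
def IsFactorwiseIso : (F F' : FactorSeq.{u}) → (F.Vertex → F'.Vertex) → Prop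
  | last G, last G', f => ∃ φ : G ≃g G', f = φ
  | cons S F, cons S' F', f =>
      ∃ (φ : S.graph ≃g S'.graph) (g : F.Vertex → F'.Vertex),
        φ '' S.K = S'.K ∧ φ '' S.I = S'.I ∧ IsFactorwiseIso F F' g ∧ f = Sum.map φ g
  | _, _, _ => False

end FactorSeq

/-! Split factors are studied inside a fixed graph as pairs `(K, I)`, with `K` complete and `I`
anticomplete to the rest. A switch meeting `K ∪ I` lies inside it, and each of its two edges and two
non-edges joins `K` to `I`. Hence activity passes to both factors of a composition, and so, given
activity, does twin-freeness.

Existence: split off a nonempty proper part of minimum size. In an active graph being split off is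
transitive (`IsSplitOff.trans`), so this part is irreducible; induct on the complement.

Uniqueness: an irreducible graph inside a composition lies on one side of it. Activity makes both
`K` and `I` of the first factor nonempty, which forces any isomorphism of products to match the
first factors (`SplitGraph.iso_inl_mem_range`); then recurse on the remaining factors. -/

/-- `a b` and `c d` are disjoint edges which a 2-switch replaces by the non-edges `a c`, `b d`. -/
def IsSwitch {V : Type u} (G : SimpleGraph V) (a b c d : V) : Prop :=
  G.Adj a b ∧ G.Adj c d ∧ Disjoint ({a, b} : Set V) {c, d} ∧ ¬ G.Adj a c ∧ ¬ G.Adj b d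

/-- The set form of a Tyshkevich composition: `(K, I)` is the bipartition of a split graph induced
in `G`, the vertices of `K` are adjacent to all vertices outside `K ∪ I`, and those of `I` to
none. -/
structure IsSplitOff {V : Type u} (G : SimpleGraph V) (K I : Set V) : Prop where
  disjoint : Disjoint K I
  isClique : G.IsClique K
  isIndepSet : G.IsIndepSet I
  adj : ∀ x ∈ K, ∀ y ∉ K ∪ I, G.Adj x y
  not_adj : ∀ x ∈ I, ∀ y ∉ K ∪ I, ¬ G.Adj x y

/-! ### Switches and twins, unfolded -/

section Switch

variable {V : Type u} {G : SimpleGraph V} {a b c d : V}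

theorem isSwitch_iff : IsSwitch G a b c d ↔
    G.Adj a b ∧ G.Adj c d ∧ a ≠ c ∧ a ≠ d ∧ b ≠ c ∧ b ≠ d ∧ ¬ G.Adj a c ∧ ¬ G.Adj b d := by
  simp only [IsSwitch, Set.disjoint_insert_left, Set.disjoint_singleton_left,
    Set.mem_insert_iff, Set.mem_singleton_iff]
  tauto

theorem isActiveVertex_iff {v : V} :
    IsActiveVertex G v ↔ ∃ b c d : V, IsSwitch G v b c d := by
  constructor
  · rintro ⟨a, b, c, d, h1, h2, h3, h4, h5, hv⟩
    have h : IsSwitch G a b c d := ⟨h1, h2, h3, h4, h5⟩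
    rw [isSwitch_iff] at h
    simp only [isSwitch_iff]
    simp only [Set.mem_insert_iff, Set.mem_singleton_iff] at hv
    rcases hv with rfl | rfl | rfl | rfl
    · exact ⟨_, _, _, h⟩
    · exact ⟨a, d, c, by grind [SimpleGraph.adj_comm]⟩
    · exact ⟨d, a, b, by grind [SimpleGraph.adj_comm]⟩
    · exact ⟨c, b, a, by grind [SimpleGraph.adj_comm]⟩
  · rintro ⟨b, c, d, h1, h2, h3, h4, h5⟩
    exact ⟨v, b, c, d, h1, h2, h3, h4, h5, by simp⟩

theorem IsSwitch.of_embedding {W : Type u} {H : SimpleGraph W} (f : H ↪g G) {a b c d : W}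
    (h : IsSwitch G (f a) (f b) (f c) (f d)) : IsSwitch H a b c d := by
  simpa [isSwitch_iff] using h

theorem areTwins_iff {x y : V} :
    AreTwins G x y ↔ ∀ w, w ≠ x → w ≠ y → (G.Adj x w ↔ G.Adj y w) := by
  simp only [AreTwins, Set.ext_iff, Set.mem_sdiff, SimpleGraph.mem_neighborSet,
    Set.mem_singleton_iff]
  refine forall_congr' fun w => ?_
  have h1 : G.Adj x w → w ≠ x := fun h => h.ne'
  have h2 : G.Adj y w → w ≠ y := fun h => h.ne'
  tauto

end Switch

/-! ### Switches relative to a split-off part -/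

namespace IsSplitOff

variable {V : Type u} {G : SimpleGraph V} {K I : Set V} {a b c d : V}

/-- A non-neighbour of a vertex of `K` lies in `I`, and a neighbour of a vertex of `I` lies in `K`;
follow the alternating cycle `a`, `c`, `d`, `b`. -/
theorem mem_left_of_switch (h : IsSplitOff G K I) (hs : IsSwitch G a b c d) (ha : a ∈ K) :
    b ∈ I ∧ c ∈ I ∧ d ∈ K := by
  obtain ⟨h1, h2, h3, h4, h5, h6, h7, h8⟩ := isSwitch_iff.1 hs
  have hc : c ∈ I := by
    by_contra hc
    by_cases hcK : c ∈ K
    · exact h7 (h.isClique ha hcK h3)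
    · exact h7 (h.adj a ha c (by simp [hc, hcK]))
  have hd : d ∈ K := by
    by_contra hd
    by_cases hdI : d ∈ I
    · exact h.isIndepSet hc hdI h2.ne h2
    · exact h.not_adj c hc d (by simp [hd, hdI]) h2
  refine ⟨?_, hc, hd⟩
  by_contra hb
  by_cases hbK : b ∈ K
  · exact h8 (h.isClique hbK hd h6)
  · exact h8 (h.adj d hd b (by simp [hb, hbK])).symm

theorem mem_right_of_switch (h : IsSplitOff G K I) (hs : IsSwitch G a b c d) (ha : a ∈ I) :
    b ∈ K ∧ c ∈ K ∧ d ∈ I := by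
  obtain ⟨h1, h2, h3, h4, h5, h6, h7, h8⟩ := isSwitch_iff.1 hs
  have hb : b ∈ K := by
    by_contra hb
    by_cases hbI : b ∈ I
    · exact h.isIndepSet ha hbI h1.ne h1
    · exact h.not_adj a ha b (by simp [hb, hbI]) h1
  have hs' : IsSwitch G b a d c := by
    rw [isSwitch_iff]
    exact ⟨h1.symm, h2.symm, h6, h5, h4, h3, h8, h7⟩
  obtain ⟨-, hd, hc⟩ := h.mem_left_of_switch hs' hb
  exact ⟨hb, hc, hd⟩

theorem mem_union_of_switch (h : IsSplitOff G K I) (hs : IsSwitch G a b c d)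
    (ha : a ∈ K ∪ I) : b ∈ K ∪ I ∧ c ∈ K ∪ I ∧ d ∈ K ∪ I := by
  rcases ha with ha | ha
  · obtain ⟨hb, hc, hd⟩ := h.mem_left_of_switch hs ha
    exact ⟨.inr hb, .inr hc, .inl hd⟩
  · obtain ⟨hb, hc, hd⟩ := h.mem_right_of_switch hs ha
    exact ⟨.inl hb, .inl hc, .inr hd⟩

theorem notMem_union_of_switch (h : IsSplitOff G K I) (hs : IsSwitch G a b c d)
    (ha : a ∉ K ∪ I) : b ∉ K ∪ I ∧ c ∉ K ∪ I ∧ d ∉ K ∪ I := by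
  have hs' := isSwitch_iff.1 hs
  -- Relabelling the switch puts `b`, `c` or `d` first and `a` in another position.
  refine ⟨fun hb => ha (h.mem_union_of_switch (b := a) (c := d) (d := c) ?_ hb).1,
    fun hc => ha (h.mem_union_of_switch (b := d) (c := a) (d := b) ?_ hc).2.1,
    fun hd => ha (h.mem_union_of_switch (b := c) (c := b) (d := a) ?_ hd).2.2⟩ <;>
  · rw [isSwitch_iff]
    grind [SimpleGraph.adj_comm]

theorem comap {W : Type u} {H : SimpleGraph W} (h : IsSplitOff G K I) (f : H ↪g G) :
    IsSplitOff H (f ⁻¹' K) (f ⁻¹' I) where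
  disjoint := h.disjoint.preimage f
  isClique _ hx _ hy hxy := f.map_adj_iff.1 (h.isClique hx hy (f.injective.ne hxy))
  isIndepSet _ hx _ hy hxy := fun hadj =>
    h.isIndepSet hx hy (f.injective.ne hxy) (f.map_adj_iff.2 hadj)
  adj _ hx _ hy := f.map_adj_iff.1 (h.adj _ hx _ hy)
  not_adj _ hx _ hy := fun hadj => h.not_adj _ hx _ hy (f.map_adj_iff.2 hadj)

/-- The split graph induced by `K ∪ I`. -/
def splitGraph (h : IsSplitOff G K I) (hne : (K ∪ I).Nonempty) : SplitGraph.{u} where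
  Vertex := ↥(K ∪ I)
  graph := G.induce (K ∪ I)
  K := Subtype.val ⁻¹' K
  I := Subtype.val ⁻¹' I
  nonempty := hne.to_subtype
  isClique := (h.comap (SimpleGraph.Embedding.induce (K ∪ I))).isClique
  isIndepSet := (h.comap (SimpleGraph.Embedding.induce (K ∪ I))).isIndepSet
  disjoint := h.disjoint.preimage _
  union_eq := Subtype.coe_preimage_self (K ∪ I)

open Classical in
theorem nonempty_iso_comp (h : IsSplitOff G K I) (hne : (K ∪ I).Nonempty) :
    Nonempty (G ≃g (h.splitGraph hne).comp (G.induce (K ∪ I)ᶜ)) := by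
  let e : ↥(K ∪ I) ⊕ ↥(K ∪ I)ᶜ ≃ V := Equiv.Set.sumCompl (K ∪ I)
  have hK : ∀ x : ↥(K ∪ I), ∀ y : ↥(K ∪ I)ᶜ, G.Adj x y ↔ (x : V) ∈ K := by
    intro x y
    refine ⟨fun hadj => ?_, fun hx => h.adj x hx y y.2⟩
    rcases x.2 with hx | hx
    · exact hx
    · exact (h.not_adj x hx y y.2 hadj).elim
  refine ⟨RelIso.symm ⟨e, ?_⟩⟩
  rintro (x | x) (y | y)
  · exact Iff.rfl
  · exact hK x y
  · exact (G.adj_comm _ _).trans (hK y x)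
  · exact Iff.rfl

end IsSplitOff

/-! ### Isomorphisms between compositions -/

section Composition

variable {V : Type u}

theorem SplitGraph.mem_I_iff (S : SplitGraph.{u}) {x : S.Vertex} : x ∈ S.I ↔ x ∉ S.K := by
  have h1 : x ∈ S.K ∪ S.I := S.union_eq ▸ Set.mem_univ x
  have h2 := S.disjoint.notMem_of_mem_left (a := x)
  rw [Set.mem_union] at h1
  tauto

/-- The embedding of the split factor into a composition. -/
def SplitGraph.inlEmbedding (S : SplitGraph.{u}) (H : SimpleGraph V) : S.graph ↪g S.comp H :=
  ⟨⟨Sum.inl, Sum.inl_injective⟩, Iff.rfl⟩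

theorem SplitGraph.isSplitOff_comp (S : SplitGraph.{u}) (H : SimpleGraph V) :
    IsSplitOff (S.comp H) (Sum.inl '' S.K) (Sum.inl '' S.I) where
  disjoint := (Set.disjoint_image_iff Sum.inl_injective).2 S.disjoint
  isClique := by
    rintro _ ⟨x, hx, rfl⟩ _ ⟨y, hy, rfl⟩ hxy
    exact S.isClique hx hy (ne_of_apply_ne _ hxy)
  isIndepSet := by
    rintro _ ⟨x, hx, rfl⟩ _ ⟨y, hy, rfl⟩ hxy
    exact S.isIndepSet hx hy (ne_of_apply_ne _ hxy)
  adj := by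
    rintro _ ⟨x, hx, rfl⟩ (y | y) hy
    · simp [S.mem_I_iff, em] at hy
    · exact hx
  not_adj := by
    rintro _ ⟨x, hx, rfl⟩ (y | y) hy
    · simp [S.mem_I_iff, em] at hy
    · exact S.mem_I_iff.1 hx

theorem SplitGraph.inl_union_inl (S : SplitGraph.{u}) :
    (Sum.inl '' S.K ∪ Sum.inl '' S.I : Set (S.Vertex ⊕ V)) = Set.range Sum.inl := by
  rw [← Set.image_union, S.union_eq, Set.image_univ]

theorem isReducible_iff {G : SimpleGraph V} : IsReducible G ↔
    ∃ K I : Set V, IsSplitOff G K I ∧ (K ∪ I).Nonempty ∧ (K ∪ I)ᶜ.Nonempty := by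
  constructor
  · rintro ⟨S, W, H, ⟨w⟩, ⟨e⟩⟩
    obtain ⟨s⟩ := S.nonempty
    refine ⟨_, _, (S.isSplitOff_comp H).comap e.toEmbedding, ⟨e.symm (.inl s), ?_⟩,
      ⟨e.symm (.inr w), ?_⟩⟩
    · rw [← Set.preimage_union, S.inl_union_inl]
      exact ⟨s, (e.apply_symm_apply _).symm⟩
    · rw [← Set.preimage_union, S.inl_union_inl]
      rintro ⟨t, ht⟩
      have := ht.trans (e.apply_symm_apply (.inr w))
      simp at this
  · rintro ⟨K, I, h, hne, hc⟩
    exact ⟨h.splitGraph hne, _, _, hc.to_subtype, h.nonempty_iso_comp hne⟩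

theorem SplitGraph.exists_mem_K_mem_I (S : SplitGraph.{u}) (h : IsActive S.graph) :
    (∃ x, x ∈ S.K) ∧ ∃ x, x ∈ S.I := by
  -- The whole of `S` is split off from itself, with nothing outside.
  have hS : IsSplitOff S.graph S.K S.I :=
    { disjoint := S.disjoint
      isClique := S.isClique
      isIndepSet := S.isIndepSet
      adj := fun x _ y hy => (hy (S.union_eq ▸ Set.mem_univ y)).elim
      not_adj := fun x _ y hy => (hy (S.union_eq ▸ Set.mem_univ y)).elim }
  obtain ⟨v⟩ := S.nonempty
  obtain ⟨b, c, d, hs⟩ := isActiveVertex_iff.1 (h v)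
  by_cases hv : v ∈ S.K
  · exact ⟨⟨v, hv⟩, b, (hS.mem_left_of_switch hs hv).1⟩
  · exact ⟨⟨b, (hS.mem_right_of_switch hs (S.mem_I_iff.2 hv)).1⟩, v, S.mem_I_iff.2 hv⟩

/-- An irreducible graph embedded in a composition lies on one side of it. -/
theorem SplitGraph.mem_range_inl_of_not_isReducible (S : SplitGraph.{u}) (H : SimpleGraph V)
    {W : Type u} {G : SimpleGraph W} (hG : ¬ IsReducible G) (f : G ↪g S.comp H) {x : W}
    (hx : f x ∈ Set.range Sum.inl) (y : W) : f y ∈ Set.range Sum.inl := by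
  by_contra hy
  refine hG (isReducible_iff.2 ⟨_, _, (S.isSplitOff_comp H).comap f, ⟨x, ?_⟩, ⟨y, ?_⟩⟩) <;>
    rw [← Set.preimage_union, S.inl_union_inl]
  exacts [hx, hy]

/-- Otherwise `S` lands entirely in `H'`. A vertex of `S'` then comes from `H`, and sees all of `S`
or none of it; but a vertex of `H` sees `K` and misses `I`, both nonempty. -/
theorem SplitGraph.iso_inl_mem_range (S S' : SplitGraph.{u}) {V' : Type u} {H : SimpleGraph V}
    {H' : SimpleGraph V'} (hS : IsPrimeGraph S.graph)
    (e : S.comp H ≃g S'.comp H') (x : S.Vertex) : e (.inl x) ∈ Set.range Sum.inl := by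
  let f : S.graph ↪g S'.comp H' := e.toEmbedding.comp (S.inlEmbedding H)
  by_contra hx
  have hout : ∀ y : S.Vertex, e (.inl y) ∉ Set.range Sum.inl := fun y hy =>
    hx (S'.mem_range_inl_of_not_isReducible H' hS.2 f (x := y) hy x)
  obtain ⟨⟨k, hk⟩, i, hi⟩ := S.exists_mem_K_mem_I hS.1
  obtain ⟨v⟩ := S'.nonempty
  obtain ⟨w, hw⟩ : ∃ w, e.symm (.inl v) = .inr w := by
    rcases h : e.symm (.inl v) with s | w
    · exact (hout s ⟨v, by rw [← h, e.apply_symm_apply]⟩).elim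
    · exact ⟨w, rfl⟩
  have key : ∀ y : S.Vertex, y ∈ S.K ↔ v ∈ S'.K := by
    intro y
    have h1 : (S.comp H).Adj (.inl y) (.inr w) ↔ y ∈ S.K := Iff.rfl
    rw [← h1, ← e.map_adj_iff, ← hw, e.apply_symm_apply]
    rcases h : e (.inl y) with s | u
    · exact (hout y ⟨s, h.symm⟩).elim
    · exact Iff.rfl
  exact S.mem_I_iff.1 hi ((key i).2 ((key k).1 hk))

/-- Applying the previous lemma to `e` and to its inverse shows that `e` respects both sides. -/
theorem SplitGraph.iso_eq_sum_map (S S' : SplitGraph.{u}) {V' : Type u} [Nonempty V]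
    {H : SimpleGraph V} {H' : SimpleGraph V'} (hS : IsPrimeGraph S.graph)
    (hS' : IsPrimeGraph S'.graph) (e : S.comp H ≃g S'.comp H') :
    ∃ (φ : S.graph ≃g S'.graph) (g : H ≃g H'),
      φ '' S.K = S'.K ∧ φ '' S.I = S'.I ∧ ⇑e = Sum.map φ g := by
  choose p hp using S.iso_inl_mem_range S' hS e
  choose q hq using S'.iso_inl_mem_range S hS' e.symm
  have hp' : ∀ y, ∃ z, Sum.inr z = e (.inr y) := by
    intro y
    rcases h : e (.inr y) with s | z
    · have := hq s
      rw [← h, e.symm_apply_apply] at this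
      simp at this
    · exact ⟨z, rfl⟩
  have hq' : ∀ y, ∃ z, Sum.inr z = e.symm (.inr y) := by
    intro y
    rcases h : e.symm (.inr y) with s | z
    · have := hp s
      rw [← h, e.apply_symm_apply] at this
      simp at this
    · exact ⟨z, rfl⟩
  choose r hr using hp'
  choose t ht using hq'
  let φ : S.graph ≃g S'.graph :=
    { toFun := p
      invFun := q
      left_inv x := Sum.inl_injective (by rw [hq, hp, e.symm_apply_apply])
      right_inv x := Sum.inl_injective (by rw [hp, hq, e.apply_symm_apply])
      map_rel_iff' := by
        intro x y
        change (S'.comp H').Adj (.inl (p x)) (.inl (p y)) ↔ (S.comp H).Adj (.inl x) (.inl y)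
        rw [hp, hp, e.map_adj_iff] }
  let g : H ≃g H' :=
    { toFun := r
      invFun := t
      left_inv x := Sum.inr_injective (by rw [ht, hr, e.symm_apply_apply])
      right_inv x := Sum.inr_injective (by rw [hr, ht, e.apply_symm_apply])
      map_rel_iff' := by
        intro x y
        change (S'.comp H').Adj (.inr (r x)) (.inr (r y)) ↔ (S.comp H).Adj (.inr x) (.inr y)
        rw [hr, hr, e.map_adj_iff] }
  have hK : ∀ x, φ x ∈ S'.K ↔ x ∈ S.K := by
    intro x
    -- `K` is recovered as the neighbours in `S` of any vertex of `H`, hence the need for `H` to be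
    -- non-null.
    have w : V := Classical.arbitrary V
    change (S'.comp H').Adj (.inl (p x)) (.inr (r w)) ↔ (S.comp H).Adj (.inl x) (.inr w)
    rw [hp, hr, e.map_adj_iff]
  refine ⟨φ, g, ?_, ?_, ?_⟩
  · ext y
    obtain ⟨x, rfl⟩ := φ.surjective y
    rw [φ.injective.mem_set_image, hK]
  · ext y
    obtain ⟨x, rfl⟩ := φ.surjective y
    rw [φ.injective.mem_set_image, S.mem_I_iff, S'.mem_I_iff, hK]
  · funext x
    rcases x with x | x
    · exact (hp x).symm
    · exact (hr x).symm

end Composition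

/-! ### Uniqueness of the decomposition -/

namespace FactorSeq

theorem AllNonnull.nonempty_vertex : ∀ {F : FactorSeq.{u}}, F.AllNonnull → Nonempty F.Vertex
  | @last _ _, h => h
  | cons _ _, h => ⟨.inl h.1.some⟩

theorem AllNonnull.noSuperfluousNull :
    ∀ {F : FactorSeq.{u}}, F.AllNonnull → F.NoSuperfluousNull
  | last _, _ => trivial
  | cons _ _, h => h

theorem not_isReducible_of_iso_cons {V : Type u} {G : SimpleGraph V} (hG : ¬ IsReducible G)
    {S : SplitGraph.{u}} {F : FactorSeq.{u}} (hF : (cons S F).IsElementalDecomposition)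
    (e : G ≃g (cons S F).product) : False :=
  hG ⟨S, F.Vertex, F.product, hF.2.2.nonempty_vertex, ⟨e⟩⟩

theorem isFactorwiseIso_of_iso : ∀ (F F' : FactorSeq.{u}), F.IsElementalDecomposition →
    F'.IsElementalDecomposition → ∀ e : F.product ≃g F'.product, IsFactorwiseIso F F' e
  | last _, last _, _, _, e => ⟨e, rfl⟩
  | last _, cons _ _, hF, hF', e => not_isReducible_of_iso_cons hF.1.1.2 hF' e
  | cons _ _, last _, hF, hF', e => not_isReducible_of_iso_cons hF'.1.1.2 hF e.symm
  | cons S F, cons S' F', hF, hF', e => by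
    have : Nonempty F.Vertex := hF.2.2.nonempty_vertex
    obtain ⟨φ, g, hK, hI, he⟩ := S.iso_eq_sum_map S' hF.1.1.1 hF'.1.1.1 e
    exact ⟨φ, g, hK, hI, isFactorwiseIso_of_iso F F' ⟨hF.1.2, hF.2.2.noSuperfluousNull⟩
      ⟨hF'.1.2, hF'.2.2.noSuperfluousNull⟩ g, he⟩

end FactorSeq

/-! ### Inheritance by factors, and transitivity -/

namespace IsSplitOff

variable {V : Type u} {G : SimpleGraph V} {K I : Set V}

theorem isActive_induce (h : IsSplitOff G K I) (hG : IsActive G) :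
    IsActive (G.induce (K ∪ I)) := by
  intro v
  obtain ⟨b, c, d, hs⟩ := isActiveVertex_iff.1 (hG v)
  obtain ⟨hb, hc, hd⟩ := h.mem_union_of_switch hs v.2
  exact isActiveVertex_iff.2 ⟨⟨b, hb⟩, ⟨c, hc⟩, ⟨d, hd⟩,
    IsSwitch.of_embedding (SimpleGraph.Embedding.induce _) hs⟩

theorem isActive_induce_compl (h : IsSplitOff G K I) (hG : IsActive G) :
    IsActive (G.induce (K ∪ I)ᶜ) := by
  intro v
  obtain ⟨b, c, d, hs⟩ := isActiveVertex_iff.1 (hG v)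
  obtain ⟨hb, hc, hd⟩ := h.notMem_union_of_switch hs v.2
  exact isActiveVertex_iff.2 ⟨⟨b, hb⟩, ⟨c, hc⟩, ⟨d, hd⟩,
    IsSwitch.of_embedding (SimpleGraph.Embedding.induce _) hs⟩

/-- Rules out twins on opposite sides of the bipartition; twins on the same side see the outside
alike, so they would be twins in `G`. -/
theorem exists_not_adj_iff_of_mem (h : IsSplitOff G K I) (hG : IsActive G) {x y : V}
    (hx : x ∈ K) (hy : y ∈ I) :
    ∃ w ∈ K ∪ I, w ≠ x ∧ w ≠ y ∧ ¬ (G.Adj x w ↔ G.Adj y w) := by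
  obtain ⟨b, c, d, hs⟩ := isActiveVertex_iff.1 (hG x)
  obtain ⟨hb, hc, hd⟩ := h.mem_left_of_switch hs hx
  obtain ⟨h1, h2, h3, h4, h5, h6, h7, h8⟩ := isSwitch_iff.1 hs
  -- The neighbour `b ∈ I` of `x` separates `x` from `y` unless it is `y`; then `d ∈ K` does.
  by_cases hby : b = y
  · subst hby
    exact ⟨d, .inl hd, h4.symm, h6.symm, fun hiff => h8 (hiff.1 (h.isClique hx hd h4))⟩
  · exact ⟨b, .inr hb, h1.ne', hby, fun hiff =>
      h.isIndepSet hy hb (Ne.symm hby) (hiff.1 h1)⟩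

theorem isTwinFree_induce (h : IsSplitOff G K I) (hG : IsActive G) (ht : IsTwinFree G) :
    IsTwinFree (G.induce (K ∪ I)) := by
  intro x y hxy htw
  rw [areTwins_iff] at htw
  have htw' : ∀ w ∈ K ∪ I, w ≠ x → w ≠ y → (G.Adj x w ↔ G.Adj y w) := fun w hw hx hy =>
    htw ⟨w, hw⟩ (fun he => hx (congrArg Subtype.val he)) (fun he => hy (congrArg Subtype.val he))
  rcases x.2 with hx | hx <;> rcases y.2 with hy | hy
  · refine ht x y (Subtype.coe_injective.ne hxy) (areTwins_iff.2 fun w hwx hwy => ?_)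
    by_cases hw : w ∈ K ∪ I
    · exact htw' w hw hwx hwy
    · exact iff_of_true (h.adj _ hx w hw) (h.adj _ hy w hw)
  · obtain ⟨w, hw, hwx, hwy, hn⟩ := h.exists_not_adj_iff_of_mem hG hx hy
    exact hn (htw' w hw hwx hwy)
  · obtain ⟨w, hw, hwy, hwx, hn⟩ := h.exists_not_adj_iff_of_mem hG hy hx
    exact hn (htw' w hw hwx hwy).symm
  · refine ht x y (Subtype.coe_injective.ne hxy) (areTwins_iff.2 fun w hwx hwy => ?_)
    by_cases hw : w ∈ K ∪ I
    · exact htw' w hw hwx hwy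
    · exact iff_of_false (h.not_adj _ hx w hw) (h.not_adj _ hy w hw)

theorem isTwinFree_induce_compl (h : IsSplitOff G K I) (ht : IsTwinFree G) :
    IsTwinFree (G.induce (K ∪ I)ᶜ) := by
  intro x y hxy htw
  rw [areTwins_iff] at htw
  refine ht x y (Subtype.coe_injective.ne hxy) (areTwins_iff.2 fun w hwx hwy => ?_)
  by_cases hw : w ∈ K ∪ I
  · rw [G.adj_comm, G.adj_comm _ w]
    rcases hw with hw | hw
    · exact iff_of_true (h.adj _ hw _ x.2) (h.adj _ hw _ y.2)
    · exact iff_of_false (h.not_adj _ hw _ x.2) (h.not_adj _ hw _ y.2)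
  · exact htw ⟨w, hw⟩ (fun he => hwx (congrArg Subtype.val he)) (fun he => hwy (congrArg Subtype.val he))

/-- In an active graph, a split graph split off from a split graph that is split off is itself
split off. -/
theorem trans (h : IsSplitOff G K I) (hG : IsActive G) {K' I' : Set ↥(K ∪ I)}
    (h' : IsSplitOff (G.induce (K ∪ I)) K' I') : IsSplitOff G ((↑) '' K') ((↑) '' I') := by
  have hact := h.isActive_induce hG
  -- The bipartitions agree: in a switch at `x`, the opposite vertex `d` is on the side of `x` for
  -- both, so being in `K'` and `I` would make `x` and `d` both adjacent and non-adjacent.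
  have hK : ∀ x ∈ K', (x : V) ∈ K := by
    intro x hx
    refine x.2.resolve_right fun hxI => ?_
    obtain ⟨b, c, d, hs⟩ := isActiveVertex_iff.1 (hact x)
    have hs' : IsSwitch G x b c d := by simpa [isSwitch_iff, Subtype.ext_iff] using hs
    exact h.isIndepSet hxI (h.mem_right_of_switch hs' hxI).2.2 (isSwitch_iff.1 hs').2.2.2.1
      (h'.isClique hx (h'.mem_left_of_switch hs hx).2.2 (isSwitch_iff.1 hs).2.2.2.1)
  have hI : ∀ x ∈ I', (x : V) ∈ I := by
    intro x hx
    refine x.2.resolve_left fun hxK => ?_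
    obtain ⟨b, c, d, hs⟩ := isActiveVertex_iff.1 (hact x)
    have hs' : IsSwitch G x b c d := by simpa [isSwitch_iff, Subtype.ext_iff] using hs
    exact h'.isIndepSet hx (h'.mem_right_of_switch hs hx).2.2 (isSwitch_iff.1 hs).2.2.2.1
      (h.isClique hxK (h.mem_left_of_switch hs' hxK).2.2 (isSwitch_iff.1 hs').2.2.2.1)
  refine ⟨(Set.disjoint_image_iff Subtype.coe_injective).2 h'.disjoint, ?_, ?_, ?_, ?_⟩
  · rintro _ ⟨x, hx, rfl⟩ _ ⟨y, hy, rfl⟩ hxy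
    exact h'.isClique hx hy (ne_of_apply_ne _ hxy)
  · rintro _ ⟨x, hx, rfl⟩ _ ⟨y, hy, rfl⟩ hxy
    exact h'.isIndepSet hx hy (ne_of_apply_ne _ hxy)
  · rintro _ ⟨x, hx, rfl⟩ y hy
    by_cases hyX : y ∈ K ∪ I
    · rw [← Set.image_union] at hy
      exact h'.adj x hx ⟨y, hyX⟩ fun hy' => hy ⟨_, hy', rfl⟩
    · exact h.adj x (hK x hx) y hyX
  · rintro _ ⟨x, hx, rfl⟩ y hy
    by_cases hyX : y ∈ K ∪ I
    · rw [← Set.image_union] at hy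
      exact h'.not_adj x hx ⟨y, hyX⟩ fun hy' => hy ⟨_, hy', rfl⟩
    · exact h.not_adj x (hI x hx) y hyX

end IsSplitOff

/-- A reducible active graph has a nonempty proper split part that induces an irreducible graph. -/
theorem IsReducible.exists_isSplitOff_not_isReducible {V : Type u} [Finite V]
    {G : SimpleGraph V} (hr : IsReducible G) (hG : IsActive G) :
    ∃ K I : Set V, IsSplitOff G K I ∧ (K ∪ I).Nonempty ∧ (K ∪ I)ᶜ.Nonempty ∧
      ¬ IsReducible (G.induce (K ∪ I)) := by
  obtain ⟨K₀, I₀, h₀⟩ := isReducible_iff.1 hr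
  obtain ⟨⟨K, I⟩, ⟨h, hne, hc⟩, hmin⟩ :=
    exists_minimalFor_of_wellFoundedLT
      (fun P : Set V × Set V =>
        IsSplitOff G P.1 P.2 ∧ (P.1 ∪ P.2).Nonempty ∧ (P.1 ∪ P.2)ᶜ.Nonempty)
      (fun P => (P.1 ∪ P.2).ncard) ⟨(K₀, I₀), h₀⟩
  refine ⟨K, I, h, hne, hc, fun hred => ?_⟩
  obtain ⟨K', I', h', hne', ⟨z, hz⟩⟩ := isReducible_iff.1 hred
  have hss : ((↑) '' K' ∪ (↑) '' I' : Set V) ⊂ K ∪ I := by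
    rw [← Set.image_union]
    refine ⟨Subtype.coe_image_subset _ _, fun hsub => ?_⟩
    obtain ⟨w, hw, hwz⟩ := hsub z.2
    exact hz (Subtype.coe_injective hwz ▸ hw)
  have hlt := Set.ncard_lt_ncard hss (Set.toFinite _)
  refine hlt.not_ge (hmin (j := ((↑) '' K', (↑) '' I')) ⟨h.trans hG h', ?_, ?_⟩ hlt.le)
  · rw [← Set.image_union]
    exact hne'.image _
  · exact hc.mono (Set.compl_subset_compl.2 hss.subset)

/-- The clause on `AllNonnull` strengthens the induction: the complement is nonempty, so prepending
a factor leaves no null factor. -/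
theorem exists_isElementalDecomposition (n : ℕ) : ∀ {V : Type u} [Finite V] (G : SimpleGraph V),
    Nat.card V = n → IsActive G → IsTwinFree G →
    ∃ F : FactorSeq.{u}, F.IsElementalDecomposition ∧ (Nonempty V → F.AllNonnull) ∧
      Nonempty (G ≃g F.product) := by
  induction n using Nat.strong_induction_on with
  | _ n ih =>
    intro V _ G hn hG ht
    by_cases hr : IsReducible G
    · obtain ⟨K, I, h, hne, hc, hirr⟩ := hr.exists_isSplitOff_not_isReducible hG
      have hlt : Nat.card ↥(K ∪ I)ᶜ < n := by
        obtain ⟨x, hx⟩ := hne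
        exact hn ▸ Finite.card_subtype_lt (x := x) (fun hx' => hx' hx)
      obtain ⟨F, hF, hnull, ⟨e⟩⟩ := ih _ hlt (G.induce (K ∪ I)ᶜ) rfl
        (h.isActive_induce_compl hG) (h.isTwinFree_induce_compl ht)
      obtain ⟨e₀⟩ := h.nonempty_iso_comp hne
      have hall : (FactorSeq.cons (h.splitGraph hne) F).AllNonnull :=
        ⟨hne.to_subtype, hnull hc.to_subtype⟩
      have e₁ : (h.splitGraph hne).comp (G.induce (K ∪ I)ᶜ) ≃g
          (FactorSeq.cons (h.splitGraph hne) F).product :=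
        ⟨Equiv.sumCongr (Equiv.refl _) e.toEquiv, by
          rintro (x | x) (y | y)
          · exact Iff.rfl
          · exact Iff.rfl
          · exact Iff.rfl
          · exact e.map_adj_iff⟩
      exact ⟨.cons (h.splitGraph hne) F, ⟨⟨⟨⟨h.isActive_induce hG, hirr⟩, h.isTwinFree_induce hG ht⟩, hF.1⟩, hall⟩,
        fun _ => hall, ⟨e₀.trans e₁⟩⟩
    · exact ⟨.last G, ⟨⟨⟨hG, hr⟩, ht⟩, trivial⟩, id, ⟨SimpleGraph.Iso.refl⟩⟩

theorem mainTheorem5 {V : Type u} [Finite V] (G : SimpleGraph V)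
    (hactive : IsActive G) (htwin : IsTwinFree G) :
    (∃ F : FactorSeq.{u}, F.IsElementalDecomposition ∧ Nonempty (G ≃g F.product)) ∧
      ∀ F F' : FactorSeq.{u}, F.IsElementalDecomposition → F'.IsElementalDecomposition →
        ∀ (e : G ≃g F.product) (e' : G ≃g F'.product),
          FactorSeq.IsFactorwiseIso F F' (fun x => e' (e.symm x)) := by
  constructor
  · obtain ⟨F, hF, -, he⟩ := exists_isElementalDecomposition _ G rfl hactive htwin
    exact ⟨F, hF, he⟩
  · intro F F' hF hF' e e'
    exact FactorSeq.isFactorwiseIso_of_iso F F' hF hF' (e.symm.trans e')
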